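/- Write $I(f)(x)=\int_0^x f(t)\,dt$, and give $C^\infty(\mathbb R)$ the topology generated by the seminorms $f\mapsto\sup_{x\in K}|D^jf(x)|$ ($j\ge 0$, $K\subseteq\mathbb R$ compact). Let $\delta\mapsto\sigma_\delta$ and $\delta\mapsto\tau_\delta$ be continuous maps from $(0,\infty)$ into $C^\infty(\mathbb R)$ such that for every $\delta>0$: - $\sigma_\delta$ maps $[0,\delta]$ into $[0,\delta]$, $\sigma_\delta(0)=0$, $D\sigma_\delta>0$ on $(0,\delta]$, and $\sigma_\delta(x)=x$ for $\delta/2\le x\le\delta$; - $\tau_\delta$ maps $[1-\delta,1]$ into $[1-\delta,1]$, $\tau_\delta(1)=1$, $D\tau_\delta>0$ on $[1-\delta,1)$, and $\tau_\delta(x)=x$ for $1-\delta\le x\le 1-\delta/2$. Then the following hold. 1. For each small enough $\delta>0$ there is a $C^\infty$ function $f\colon[0,1]\to[0,1]$ such that $f=\sigma_\delta$ on $[0,\delta]$, $f=\tau_\delta$ on $[1-\delta,1]$, and $Df>0$ on $(0,1)$. 2. Let $0<a<1$. For each small enough $\delta>0$ there is a $C^\infty$ function $f\colon[0,1]\to[0,1]$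 such that $f=\sigma_\delta$ on $[0,\delta/2]$, $f=\tau_\delta$ on $[1-\delta/2,1]$, $Df>0$ on $(0,1)$, and $I(f)(1)=a$. 3. Let $a,b\in\mathbb R$ satisfy $0<a<1$ and $a^2/2<b<a/2$. For each small enough $\delta>0$ there is a $C^\infty$ function $f\colon[0,1]\to[0,1]$ such that $f=\sigma_\delta$ on $[0,\delta/2]$, $f=\tau_\delta$ on $[1-\delta/2,1]$, $Df>0$ on $(0,1)$, $I(f)(1)=a$, and $I^2(f)(1)=b$. -/

import Mathlib

open Set Filter Topology
open scoped ContDiff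

/-- `F` restricted to the positive reals is a continuous map into `C^∞(ℝ)`, where `C^∞(ℝ)` carries
the topology generated by the seminorms `f ↦ sup_K |D^j f|` (`K` compact, `j ≥ 0`), that is, the
topology of uniform convergence of all derivatives on compact sets. -/
structure IsContinuousSmoothFamily (F : ℝ → ℝ → ℝ) : Prop where
  contDiff : ∀ δ : ℝ, 0 < δ → ContDiff ℝ ∞ (F δ)
  continuous : ∀ δ₀ : ℝ, 0 < δ₀ → ∀ (j : ℕ) (K : Set ℝ), IsCompact K →
    TendstoUniformlyOn (fun δ : ℝ => iteratedDeriv j (F δ)) (iteratedDeriv j (F δ₀)) (𝓝 δ₀) K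

/-- The standing requirements on the left endpoint pieces `σ_δ : [0, δ] → [0, δ]`, `δ > 0`. -/
structure IsLeftPieceFamily (σ : ℝ → ℝ → ℝ) : Prop where
  family : IsContinuousSmoothFamily σ
  mapsTo : ∀ δ : ℝ, 0 < δ → MapsTo (σ δ) (Icc 0 δ) (Icc 0 δ)
  map_zero : ∀ δ : ℝ, 0 < δ → σ δ 0 = 0
  deriv_pos : ∀ δ : ℝ, 0 < δ → ∀ x ∈ Ioc 0 δ, 0 < deriv (σ δ) x
  eq_self : ∀ δ : ℝ, 0 < δ → ∀ x ∈ Icc (δ / 2) δ, σ δ x = x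

/-- The standing requirements on the right endpoint pieces `τ_δ : [1 - δ, 1] → [1 - δ, 1]`,
`δ > 0`. -/
structure IsRightPieceFamily (τ : ℝ → ℝ → ℝ) : Prop where
  family : IsContinuousSmoothFamily τ
  mapsTo : ∀ δ : ℝ, 0 < δ → MapsTo (τ δ) (Icc (1 - δ) 1) (Icc (1 - δ) 1)
  map_one : ∀ δ : ℝ, 0 < δ → τ δ 1 = 1
  deriv_pos : ∀ δ : ℝ, 0 < δ → ∀ x ∈ Ico (1 - δ) 1, 0 < deriv (τ δ) x
  eq_self : ∀ δ : ℝ, 0 < δ → ∀ x ∈ Icc (1 - δ) (1 - δ / 2), τ δ x = x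

/-- `f` (through its values on `[0, 1]`) is a `C^∞` function `[0, 1] → [0, 1]` with `f = s` on
`[0, r]`, `f = t` on `[1 - r, 1]` and `Df > 0` on `(0, 1)`. -/
structure IsSmoothJoin (s t : ℝ → ℝ) (r : ℝ) (f : ℝ → ℝ) : Prop where
  contDiffOn : ContDiffOn ℝ ∞ f (Icc 0 1)
  mapsTo : MapsTo f (Icc 0 1) (Icc 0 1)
  eq_left : ∀ x ∈ Icc 0 r, f x = s x
  eq_right : ∀ x ∈ Icc (1 - r) 1, f x = t x
  deriv_pos : ∀ x ∈ Ioo (0 : ℝ) 1, 0 < deriv f x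

/-- The integral operator `I(f)(x) = ∫₀ˣ f(t) dt`. -/
noncomputable def integralOp (f : ℝ → ℝ) : ℝ → ℝ := fun x => ∫ t in (0 : ℝ)..x, f t

/-! The moments `f ↦ (I f 1, I² f 1)` depend affinely on `f`, and the smooth joins for a fixed `δ`
form a convex set. The unit step at `1 - u` has moments `(u, u² / 2)`, and the region `a² / 2 < b <
a / 2` is the interior of the convex hull of this parabola arc over `[0, 1]`. So `(a, b)` lies
strictly inside a triangle with vertices on the arc. For small `δ`, joins come close to the three
steps (`exists_isSmoothJoin_near_step`). Strict containment survives the error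
(`exists_signedArea_pos_of_near`), and a convex combination of the three joins has moments exactly
`(a, b)`.

A join near a step is the glued identity minus a correction `F` fixed before `δ`
(`exists_smooth_step_correction`). Where `F` is nonzero the glued function has slope `1`, so `F' <
1` keeps the difference increasing. -/

/-- The function equal to `s` on `(-∞, δ]`, to `t` on `[1 - δ, ∞)` and to the identity between. -/
noncomputable def glueId (s t : ℝ → ℝ) (δ : ℝ) : ℝ → ℝ :=
  fun x => if x ≤ δ then s x else if x < 1 - δ then x else t x

/-! ### Gluing the end pieces to the identity -/

section Glue

variable {s t : ℝ → ℝ} {δ : ℝ}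

lemma glueId_of_le {x : ℝ} (hx : x ≤ δ) : glueId s t δ x = s x := by
  simp [glueId, hx]

lemma glueId_of_ge (hδ : δ < 1 / 2) {x : ℝ} (hx : 1 - δ ≤ x) : glueId s t δ x = t x := by
  have h1 : ¬ x ≤ δ := by linarith
  have h2 : ¬ x < 1 - δ := by linarith
  simp [glueId, h1, h2]

lemma glueId_of_mem (hs : ∀ x ∈ Icc (δ / 2) δ, s x = x)
    (ht : ∀ x ∈ Icc (1 - δ) (1 - δ / 2), t x = x) {x : ℝ}
    (hx : x ∈ Icc (δ / 2) (1 - δ / 2)) : glueId s t δ x = x := by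
  unfold glueId
  split_ifs with h1 h2
  · exact hs x ⟨hx.1, h1⟩
  · rfl
  · exact ht x ⟨not_lt.1 h2, hx.2⟩

lemma glueId_eventuallyEq_left {x : ℝ} (hx : x < δ) : glueId s t δ =ᶠ[𝓝 x] s := by
  filter_upwards [Iio_mem_nhds hx] with y hy using glueId_of_le (le_of_lt hy)

lemma glueId_eventuallyEq_right (hδ : δ < 1 / 2) {x : ℝ} (hx : 1 - δ < x) :
    glueId s t δ =ᶠ[𝓝 x] t := by
  filter_upwards [Ioi_mem_nhds hx] with y hy using glueId_of_ge hδ (le_of_lt hy)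

lemma glueId_eventuallyEq_id (hs : ∀ x ∈ Icc (δ / 2) δ, s x = x)
    (ht : ∀ x ∈ Icc (1 - δ) (1 - δ / 2), t x = x) {x : ℝ}
    (hx : x ∈ Ioo (δ / 2) (1 - δ / 2)) : glueId s t δ =ᶠ[𝓝 x] fun y => y := by
  filter_upwards [Ioo_mem_nhds hx.1 hx.2] with y hy
    using glueId_of_mem hs ht (Ioo_subset_Icc_self hy)

/-- Since `s` and `t` are already the identity on half of their collars, the open sets `x < δ`, `δ /
2 < x < 1 - δ / 2` and `1 - δ < x` cover the line, and on each of them a single smooth formula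
holds. -/
lemma contDiff_glueId (h0 : 0 < δ) (hδ : δ < 1 / 2) (hs : ∀ x ∈ Icc (δ / 2) δ, s x = x)
    (ht : ∀ x ∈ Icc (1 - δ) (1 - δ / 2), t x = x) (hsc : ContDiff ℝ ∞ s)
    (htc : ContDiff ℝ ∞ t) : ContDiff ℝ ∞ (glueId s t δ) := by
  refine contDiff_iff_contDiffAt.2 fun x => ?_
  rcases lt_or_ge x δ with h1 | h1
  · exact hsc.contDiffAt.congr_of_eventuallyEq (glueId_eventuallyEq_left h1)
  rcases lt_or_ge (1 - δ) x with h2 | h2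
  · exact htc.contDiffAt.congr_of_eventuallyEq (glueId_eventuallyEq_right hδ h2)
  · exact contDiffAt_id.congr_of_eventuallyEq
      (glueId_eventuallyEq_id hs ht ⟨by linarith, by linarith⟩)

lemma deriv_glueId_of_mem (hs : ∀ x ∈ Icc (δ / 2) δ, s x = x)
    (ht : ∀ x ∈ Icc (1 - δ) (1 - δ / 2), t x = x) {x : ℝ}
    (hx : x ∈ Ioo (δ / 2) (1 - δ / 2)) : deriv (glueId s t δ) x = 1 := by
  rw [(glueId_eventuallyEq_id hs ht hx).deriv_eq, deriv_id'']

lemma deriv_glueId_pos (h0 : 0 < δ) (hδ : δ < 1 / 2) (hs : ∀ x ∈ Icc (δ / 2) δ, s x = x)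
    (ht : ∀ x ∈ Icc (1 - δ) (1 - δ / 2), t x = x) (hsd : ∀ x ∈ Ioc 0 δ, 0 < deriv s x)
    (htd : ∀ x ∈ Ico (1 - δ) 1, 0 < deriv t x) {x : ℝ} (hx : x ∈ Ioo (0 : ℝ) 1) :
    0 < deriv (glueId s t δ) x := by
  rcases lt_or_ge x δ with h1 | h1
  · rw [(glueId_eventuallyEq_left h1).deriv_eq]
    exact hsd x ⟨hx.1, h1.le⟩
  rcases lt_or_ge (1 - δ) x with h2 | h2
  · rw [(glueId_eventuallyEq_right hδ h2).deriv_eq]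
    exact htd x ⟨h2.le, hx.2⟩
  · rw [deriv_glueId_of_mem hs ht ⟨by linarith, by linarith⟩]
    exact one_pos

lemma abs_glueId_sub_le (h0 : 0 < δ) (hδ : δ < 1 / 2) (hs : ∀ x ∈ Icc (δ / 2) δ, s x = x)
    (ht : ∀ x ∈ Icc (1 - δ) (1 - δ / 2), t x = x) (hsm : MapsTo s (Icc 0 δ) (Icc 0 δ))
    (htm : MapsTo t (Icc (1 - δ) 1) (Icc (1 - δ) 1)) {x : ℝ} (hx : x ∈ Icc (0 : ℝ) 1) :
    |glueId s t δ x - x| ≤ δ := by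
  rcases le_or_gt x δ with h1 | h1
  · rw [glueId_of_le h1]
    have := hsm ⟨hx.1, h1⟩
    exact abs_le.2 ⟨by linarith [this.1], by linarith [this.2, hx.1]⟩
  rcases le_or_gt (1 - δ) x with h2 | h2
  · rw [glueId_of_ge hδ h2]
    have := htm ⟨h2, hx.2⟩
    exact abs_le.2 ⟨by linarith [this.1, hx.2], by linarith [this.2]⟩
  · rw [glueId_of_mem hs ht ⟨by linarith, by linarith⟩]
    simpa using h0.le

end Glue

/-! ### Convexity of joins and linearity of the moments -/

section Join

variable {s t f g : ℝ → ℝ} {r : ℝ}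

lemma mapsTo_Icc_of_deriv_pos (hf : ContinuousOn f (Icc 0 1)) (h0 : f 0 = 0) (h1 : f 1 = 1)
    (hd : ∀ x ∈ Ioo (0 : ℝ) 1, 0 < deriv f x) : MapsTo f (Icc 0 1) (Icc 0 1) := by
  have hm : StrictMonoOn f (Icc 0 1) :=
    strictMonoOn_of_deriv_pos (convex_Icc 0 1) hf (by simpa [interior_Icc] using hd)
  intro x hx
  have ha := hm.monotoneOn (left_mem_Icc.2 zero_le_one) hx hx.1
  have hb := hm.monotoneOn hx (right_mem_Icc.2 zero_le_one) hx.2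
  exact ⟨h0 ▸ ha, h1 ▸ hb⟩

lemma IsSmoothJoin.differentiableAt (hf : IsSmoothJoin s t r f) {x : ℝ}
    (hx : x ∈ Ioo (0 : ℝ) 1) : DifferentiableAt ℝ f x :=
  (hf.contDiffOn.contDiffAt (Icc_mem_nhds hx.1 hx.2)).differentiableAt (by simp)

lemma IsSmoothJoin.convexComb (hf : IsSmoothJoin s t r f) (hg : IsSmoothJoin s t r g)
    {p q : ℝ} (hp : 0 ≤ p) (hq : 0 ≤ q) (hpq : p + q = 1) :
    IsSmoothJoin s t r (fun x => p * f x + q * g x) where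
  contDiffOn := (contDiffOn_const.mul hf.contDiffOn).add (contDiffOn_const.mul hg.contDiffOn)
  mapsTo := fun x hx => by
    simpa using convex_Icc (0 : ℝ) 1 (hf.mapsTo hx) (hg.mapsTo hx) hp hq hpq
  eq_left := fun x hx => by
    rw [hf.eq_left x hx, hg.eq_left x hx, ← add_mul, hpq, one_mul]
  eq_right := fun x hx => by
    rw [hf.eq_right x hx, hg.eq_right x hx, ← add_mul, hpq, one_mul]
  deriv_pos := fun x hx => by
    have hd : deriv (fun x => p * f x + q * g x) x = p * deriv f x + q * deriv g x :=
      (((hf.differentiableAt hx).hasDerivAt.const_mul p).add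
        ((hg.differentiableAt hx).hasDerivAt.const_mul q)).deriv
    rw [hd]
    have h1 := hf.deriv_pos x hx
    have h2 := hg.deriv_pos x hx
    rcases hp.eq_or_lt with rfl | hp'
    · have : q = 1 := by linarith
      subst this
      simpa using h2
    · have := mul_pos hp' h1
      have := mul_nonneg hq h2.le
      linarith

lemma integralOp_continuousOn (hf : ContinuousOn f (Icc 0 1)) :
    ContinuousOn (integralOp f) (Icc 0 1) := by
  have hi : MeasureTheory.IntegrableOn f (uIcc 0 1) := by
    rw [uIcc_of_le zero_le_one]
    exact hf.integrableOn_Icc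
  have := intervalIntegral.continuousOn_primitive_interval hi
  rwa [uIcc_of_le zero_le_one] at this

lemma intervalIntegrable_of_continuousOn_unit (hf : ContinuousOn f (Icc 0 1)) {x y : ℝ}
    (hx : x ∈ Icc (0 : ℝ) 1) (hy : y ∈ Icc (0 : ℝ) 1) :
    IntervalIntegrable f MeasureTheory.volume x y :=
  (hf.mono (ordConnected_Icc.uIcc_subset hx hy)).intervalIntegrable

lemma integralOp_convexComb (hf : ContinuousOn f (Icc 0 1)) (hg : ContinuousOn g (Icc 0 1))
    (p q : ℝ) {x : ℝ} (hx : x ∈ Icc (0 : ℝ) 1) :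
    integralOp (fun x => p * f x + q * g x) x = p * integralOp f x + q * integralOp g x := by
  have h0 : (0 : ℝ) ∈ Icc (0 : ℝ) 1 := left_mem_Icc.2 zero_le_one
  simp only [integralOp]
  rw [intervalIntegral.integral_add, intervalIntegral.integral_const_mul,
    intervalIntegral.integral_const_mul]
  · exact (intervalIntegrable_of_continuousOn_unit hf h0 hx).const_mul p
  · exact (intervalIntegrable_of_continuousOn_unit hg h0 hx).const_mul q

lemma integralOp_congr (h : EqOn f g (Icc 0 1)) {x : ℝ} (hx : x ∈ Icc (0 : ℝ) 1) :
    integralOp f x = integralOp g x := by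
  refine intervalIntegral.integral_congr fun y hy => h ?_
  exact ordConnected_Icc.uIcc_subset (left_mem_Icc.2 zero_le_one) hx hy

lemma integralOp_integralOp_convexComb (hf : ContinuousOn f (Icc 0 1))
    (hg : ContinuousOn g (Icc 0 1)) (p q : ℝ) {x : ℝ} (hx : x ∈ Icc (0 : ℝ) 1) :
    integralOp (integralOp fun x => p * f x + q * g x) x =
      p * integralOp (integralOp f) x + q * integralOp (integralOp g) x := by
  rw [← integralOp_convexComb (integralOp_continuousOn hf) (integralOp_continuousOn hg) p q hx]
  exact integralOp_congr (fun y hy => integralOp_convexComb hf hg p q hy) hx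

end Join

/-! ### Smooth approximations of a unit step -/

section Step

variable {f : ℝ → ℝ} {s ε : ℝ}

/-- If `f` is close to the unit step at `s`, its primitive is close to `x ↦ max (x - s) 0`. -/
lemma abs_integralOp_sub_max_le (hε : 0 < ε) (hs : ε < s) (hs' : ε < 1 - s)
    (hf : ContinuousOn f (Icc 0 1)) (hm : MapsTo f (Icc 0 1) (Icc 0 1))
    (hl : ∀ x ∈ Icc 0 (s - ε), f x ≤ 2 * ε) (hr : ∀ x ∈ Icc (s + ε) 1, 1 - 2 * ε ≤ f x)
    {x : ℝ} (hx : x ∈ Icc (0 : ℝ) 1) : |integralOp f x - max (x - s) 0| ≤ 3 * ε := by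
  have h0 : (0 : ℝ) ∈ Icc (0 : ℝ) 1 := left_mem_Icc.2 zero_le_one
  have upper : ∀ u v C : ℝ, 0 ≤ u → u ≤ v → v ≤ 1 → (∀ y ∈ Icc u v, f y ≤ C) →
      ∫ y in u..v, f y ≤ C * (v - u) := by
    intro u v C hu huv hv hC
    have hi := intervalIntegrable_of_continuousOn_unit hf ⟨hu, huv.trans hv⟩ ⟨hu.trans huv, hv⟩
    have := intervalIntegral.integral_mono_on huv hi intervalIntegrable_const hC
    simpa [mul_comm] using this
  have lower : ∀ u v C : ℝ, 0 ≤ u → u ≤ v → v ≤ 1 → (∀ y ∈ Icc u v, C ≤ f y) →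
      C * (v - u) ≤ ∫ y in u..v, f y := by
    intro u v C hu huv hv hC
    have hi := intervalIntegrable_of_continuousOn_unit hf ⟨hu, huv.trans hv⟩ ⟨hu.trans huv, hv⟩
    have := intervalIntegral.integral_mono_on huv intervalIntegrable_const hi hC
    simpa [mul_comm] using this
  have split : ∀ u ∈ Icc (0 : ℝ) 1, integralOp f x = (∫ y in (0 : ℝ)..u, f y) + ∫ y in u..x, f y :=
    fun u hu => (intervalIntegral.integral_add_adjacent_intervals
      (intervalIntegrable_of_continuousOn_unit hf h0 hu)
      (intervalIntegrable_of_continuousOn_unit hf hu hx)).symm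
  have hnn : 0 ≤ integralOp f x := by
    have := lower 0 x 0 le_rfl hx.1 hx.2 fun y hy => (hm ⟨hy.1, hy.2.trans hx.2⟩).1
    simpa [integralOp] using this
  refine abs_le.2 ⟨?_, ?_⟩
  · rcases le_total x (s + ε) with h | h
    · have : max (x - s) 0 ≤ ε := max_le (by linarith) hε.le
      linarith
    -- The transition window costs `ε` and the defect `2 * ε` of `f` costs at most `2 * ε`, hence `3
    -- * ε`; the upper bound has the same budget.
    · rw [max_eq_left (by linarith), split (s + ε) ⟨by linarith, by linarith⟩]
      have h1 := lower 0 (s + ε) 0 le_rfl (by linarith) (by linarith)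
        fun y hy => (hm ⟨hy.1, by linarith [hy.2]⟩).1
      have h2 := lower (s + ε) x (1 - 2 * ε) (by linarith) h hx.2
        fun y hy => hr y ⟨hy.1, hy.2.trans hx.2⟩
      have h3 : ε * (x - (s + ε)) ≤ ε * 1 :=
        mul_le_mul_of_nonneg_left (by linarith [hx.2]) hε.le
      linarith
  · have hmax := le_max_left (x - s) 0
    have hmax' := le_max_right (x - s) 0
    rcases le_total x (s - ε) with h | h
    · have h1 := upper 0 x (2 * ε) le_rfl hx.1 hx.2 fun y hy => hl y ⟨hy.1, hy.2.trans h⟩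
      have h3 : ε * x ≤ ε * 1 := mul_le_mul_of_nonneg_left hx.2 hε.le
      have h4 : integralOp f x = ∫ y in (0 : ℝ)..x, f y := rfl
      linarith
    · rw [split (s - ε) ⟨by linarith, by linarith⟩]
      have h1 := upper 0 (s - ε) (2 * ε) le_rfl (by linarith) (by linarith) hl
      have h2 := upper (s - ε) x 1 (by linarith) h hx.2
        fun y hy => (hm ⟨by linarith [hy.1], hy.2.trans hx.2⟩).2
      have h3 : ε * (s - ε) ≤ ε * 1 := mul_le_mul_of_nonneg_left (by linarith) hε.le
      linarith

lemma integral_max_sub_zero (h0 : 0 ≤ s) (h1 : s ≤ 1) :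
    ∫ x in (0 : ℝ)..1, max (x - s) 0 = (1 - s) ^ 2 / 2 := by
  have hc : Continuous fun x : ℝ => max (x - s) 0 := by fun_prop
  rw [← intervalIntegral.integral_add_adjacent_intervals (hc.intervalIntegrable 0 s)
    (hc.intervalIntegrable s 1)]
  have ha : ∫ x in (0 : ℝ)..s, max (x - s) 0 = ∫ x in (0 : ℝ)..s, (0 : ℝ) := by
    refine intervalIntegral.integral_congr fun x hx => ?_
    rw [uIcc_of_le h0] at hx
    exact max_eq_right (by linarith [hx.2])
  have hb : ∫ x in s..1, max (x - s) 0 = ∫ x in s..1, (x - s) := by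
    refine intervalIntegral.integral_congr fun x hx => ?_
    rw [uIcc_of_le h1] at hx
    exact max_eq_left (by linarith [hx.1])
  rw [ha, hb, intervalIntegral.integral_comp_sub_right (fun x => x) s]
  simp

lemma abs_integralOp_integralOp_sub_le (hε : 0 < ε) (hs : ε < s) (hs' : ε < 1 - s)
    (hf : ContinuousOn f (Icc 0 1)) (hm : MapsTo f (Icc 0 1) (Icc 0 1))
    (hl : ∀ x ∈ Icc 0 (s - ε), f x ≤ 2 * ε) (hr : ∀ x ∈ Icc (s + ε) 1, 1 - 2 * ε ≤ f x) :
    |integralOp (integralOp f) 1 - (1 - s) ^ 2 / 2| ≤ 3 * ε := by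
  have h0 : (0 : ℝ) ∈ Icc (0 : ℝ) 1 := left_mem_Icc.2 zero_le_one
  have h1 : (1 : ℝ) ∈ Icc (0 : ℝ) 1 := right_mem_Icc.2 zero_le_one
  have hc : Continuous fun x : ℝ => max (x - s) 0 := by fun_prop
  rw [← integral_max_sub_zero (by linarith) (by linarith), integralOp,
    ← intervalIntegral.integral_sub
      (intervalIntegrable_of_continuousOn_unit (integralOp_continuousOn hf) h0 h1)
      (hc.intervalIntegrable 0 1)]
  have := intervalIntegral.norm_integral_le_of_norm_le_const (a := (0 : ℝ)) (b := 1) (C := 3 * ε)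
    (f := fun x => integralOp f x - max (x - s) 0) fun x hx => by
      rw [uIoc_of_le zero_le_one] at hx
      exact abs_integralOp_sub_max_le hε hs hs' hf hm hl hr (Ioc_subset_Icc_self hx)
  simpa using this

/-- A smooth `F`, supported away from the endpoints of `[0, 1]` and with `F' < 1`, such that
`x ↦ x - F x` is close to the unit step at `s`. -/
lemma exists_smooth_step_correction (hε : 0 < ε) (hs : 2 * ε < s) (hs' : 2 * ε < 1 - s) :
    ∃ F : ℝ → ℝ, ContDiff ℝ ∞ F ∧ (∀ x ≤ ε / 4, F x = 0) ∧ (∀ x, 1 - ε / 4 ≤ x → F x = 0) ∧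
      (∀ x, deriv F x < 1) ∧ (∀ x ∈ Icc 0 (s - ε), x - F x ≤ ε) ∧
      ∀ x ∈ Icc (s + ε) 1, 1 - ε ≤ x - F x := by
  -- `F' = A - c N`: the plateau `A < 1` nearly cancels the slope of `x`, and the unit-mass bump `N`
  -- makes `x - F x` jump by `c` near `s`. Taking `c = ∫ A` gives `F 1 = 0`.
  let A₀ : ContDiffBump (1 / 2 : ℝ) := ⟨1 / 2 - ε / 2, 1 / 2 - ε / 4, by linarith, by linarith⟩
  let N₀ : ContDiffBump s := ⟨ε / 2, ε, by linarith, by linarith⟩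
  let A : ℝ → ℝ := fun x => (1 - ε / 2) * A₀ x
  let N : ℝ → ℝ := N₀.normed MeasureTheory.volume
  have hAc : ContDiff ℝ ∞ A := contDiff_const.mul A₀.contDiff
  have hNc : ContDiff ℝ ∞ N := N₀.contDiff_normed
  have hA0 : ∀ x, 0 ≤ A x := fun x => mul_nonneg (by linarith) A₀.nonneg
  have hA1 : ∀ x, A x < 1 := fun x => by
    have := mul_le_mul_of_nonneg_left (A₀.le_one (x := x)) (by linarith : 0 ≤ 1 - ε / 2)
    simp only [A]
    linarith
  have hN0 : ∀ x, 0 ≤ N x := N₀.nonneg_normed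
  have hA_in : ∀ x ∈ Icc (ε / 2) (1 - ε / 2), A x = 1 - ε / 2 := fun x hx => by
    have : A₀ x = 1 := A₀.one_of_mem_closedBall (by
      rw [Metric.mem_closedBall, Real.dist_eq, abs_le]
      exact ⟨by simp only [A₀]; linarith [hx.1], by simp only [A₀]; linarith [hx.2]⟩)
    simp [A, this]
  have hA_out : ∀ x, (x ≤ ε / 4 ∨ 1 - ε / 4 ≤ x) → A x = 0 := fun x hx => by
    have : A₀ x = 0 := A₀.zero_of_le_dist (by
      rw [Real.dist_eq, le_abs]
      rcases hx with hx | hx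
      · right; simp only [A₀]; linarith
      · left; simp only [A₀]; linarith)
    simp [A, this]
  have hN_out : ∀ x, (x ≤ s - ε ∨ s + ε ≤ x) → N x = 0 := fun x hx => by
    have : N₀ x = 0 := N₀.zero_of_le_dist (by
      rw [Real.dist_eq, le_abs]
      rcases hx with hx | hx
      · right; simp only [N₀]; linarith
      · left; simp only [N₀]; linarith)
    simp [N, ContDiffBump.normed_def, this]
  have hAi : ∀ u v, IntervalIntegrable A MeasureTheory.volume u v :=
    fun u v => hAc.continuous.intervalIntegrable u v
  have hNi : ∀ u v, IntervalIntegrable N MeasureTheory.volume u v :=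
    fun u v => hNc.continuous.intervalIntegrable u v
  have hNint : ∫ x in (0 : ℝ)..1, N x = 1 := by
    refine Eq.trans ?_ (N₀.integral_normed (μ := MeasureTheory.volume))
    refine intervalIntegral.integral_eq_integral_of_support_subset fun x hx => ?_
    by_contra h
    refine hx (hN_out x ?_)
    by_contra! h'
    exact h ⟨by linarith, by linarith⟩
  set c := ∫ x in (0 : ℝ)..1, A x with hc
  have hc0 : 0 ≤ c := intervalIntegral.integral_nonneg zero_le_one fun x _ => hA0 x
  let G : ℝ → ℝ := fun x => A x - c * N x
  have hGc : ContDiff ℝ ∞ G := hAc.sub (contDiff_const.mul hNc)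
  let F : ℝ → ℝ := fun x => ∫ y in (0 : ℝ)..x, G y
  have hFd : ∀ x, HasDerivAt F (G x) x := fun x => by
    exact hGc.continuous.integral_hasStrictDerivAt 0 x |>.hasDerivAt
  have hF1 : F 1 = 0 := by
    change ∫ x in (0 : ℝ)..1, (A x - c * N x) = 0
    rw [intervalIntegral.integral_sub (hAi _ _) ((hNi _ _).const_mul c),
      intervalIntegral.integral_const_mul c N, hNint, ← hc, mul_one, sub_self]
  have hF_left : ∀ x ≤ s - ε, F x = ∫ y in (0 : ℝ)..x, A y := fun x hx => by
    refine intervalIntegral.integral_congr fun y hy => ?_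
    have : y ≤ s - ε := (ordConnected_Iic.uIcc_subset (mem_Iic.2 (by linarith)) hx) hy
    simp [G, hN_out y (Or.inl this)]
  have hF_right : ∀ x, s + ε ≤ x → F x = - ∫ y in x..1, A y := fun x hx => by
    have h1 : F x + ∫ y in x..1, G y = F 1 :=
      intervalIntegral.integral_add_adjacent_intervals
        (hGc.continuous.intervalIntegrable _ _) (hGc.continuous.intervalIntegrable _ _)
    have h2 : ∫ y in x..1, G y = ∫ y in x..1, A y := by
      refine intervalIntegral.integral_congr fun y hy => ?_
      have : s + ε ≤ y := (ordConnected_Ici.uIcc_subset hx (mem_Ici.2 (by linarith))) hy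
      simp [G, hN_out y (Or.inr this)]
    linarith
  have hAin_int : ∀ u v, ε / 2 ≤ u → u ≤ v → v ≤ 1 - ε / 2 →
      ∫ y in u..v, A y = (1 - ε / 2) * (v - u) := fun u v hu huv hv => by
    have : ∫ y in u..v, A y = ∫ y in u..v, (1 - ε / 2) := by
      refine intervalIntegral.integral_congr fun y hy => ?_
      rw [uIcc_of_le huv] at hy
      exact hA_in y ⟨hu.trans hy.1, hy.2.trans hv⟩
    rw [this, intervalIntegral.integral_const, smul_eq_mul, mul_comm]
  refine ⟨F, ?_, fun x hx => ?_, fun x hx => ?_, fun x => ?_, fun x hx => ?_, fun x hx => ?_⟩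
  · refine contDiff_infty_iff_deriv.2 ⟨fun x => (hFd x).differentiableAt, ?_⟩
    rwa [show deriv F = G from funext fun x => (hFd x).deriv]
  · rw [hF_left x (by linarith)]
    refine intervalIntegral.integral_zero_ae (Eventually.of_forall fun y hy => hA_out y (Or.inl ?_))
    exact (ordConnected_Iic.uIcc_subset (mem_Iic.2 (by linarith)) hx) (uIoc_subset_uIcc hy)
  · rw [hF_right x (by linarith), neg_eq_zero]
    refine intervalIntegral.integral_zero_ae (Eventually.of_forall fun y hy => hA_out y (Or.inr ?_))
    exact (ordConnected_Ici.uIcc_subset hx (mem_Ici.2 (by linarith))) (uIoc_subset_uIcc hy)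
  · rw [(hFd x).deriv]
    have := mul_nonneg hc0 (hN0 x)
    have := hA1 x
    simp only [G]
    linarith
  -- `x - F x` gains at most `ε / 2` before the plateau of `A` begins, and at most `ε / 2` along it,
  -- where its slope is `ε / 2`. The other end is symmetric.
  · rw [hF_left x hx.2]
    rcases le_total x (ε / 2) with h | h
    · have := intervalIntegral.integral_nonneg hx.1 (fun y _ => hA0 y) (μ := MeasureTheory.volume)
      linarith
    · have h1 := intervalIntegral.integral_nonneg (by linarith : 0 ≤ ε / 2) (fun y _ => hA0 y)
        (μ := MeasureTheory.volume)
      have h2 := hAin_int (ε / 2) x le_rfl h (by linarith [hx.2])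
      have h3 := intervalIntegral.integral_add_adjacent_intervals (hAi 0 (ε / 2)) (hAi (ε / 2) x)
      rw [← h3, h2]
      have h4 : ε / 2 * (x - ε / 2) ≤ ε / 2 * 1 :=
        mul_le_mul_of_nonneg_left (by linarith [hx.2]) (by linarith)
      linarith
  · rw [hF_right x hx.1]
    rcases le_total (1 - ε / 2) x with h | h
    · have := intervalIntegral.integral_nonneg hx.2 (fun y _ => hA0 y) (μ := MeasureTheory.volume)
      linarith
    · have h1 := intervalIntegral.integral_nonneg (by linarith : 1 - ε / 2 ≤ 1) (fun y _ => hA0 y)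
        (μ := MeasureTheory.volume)
      have h2 := hAin_int x (1 - ε / 2) (by linarith [hx.1]) h le_rfl
      have h3 := intervalIntegral.integral_add_adjacent_intervals (hAi x (1 - ε / 2))
        (hAi (1 - ε / 2) 1)
      rw [← h3, h2]
      have h4 : ε / 2 * (1 - ε / 2 - x) ≤ ε / 2 * 1 :=
        mul_le_mul_of_nonneg_left (by linarith [hx.1]) (by linarith)
      linarith

end Step

/-! ### Joins with moments near those of a step -/

section Families

variable {σ τ : ℝ → ℝ → ℝ} {δ : ℝ}

/-- A correction `F` with `F' < 1`, supported away from the `δ`-collars of the endpoints, turns the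
glued function into another smooth join. -/
lemma isSmoothJoin_glueId_sub (hσ : IsLeftPieceFamily σ) (hτ : IsRightPieceFamily τ) (h0 : 0 < δ)
    (hδ : δ < 1 / 2) {F : ℝ → ℝ} {η r : ℝ} (hη : δ / 2 < η) (hr : r ≤ η) (hrδ : r ≤ δ)
    (hr0 : 0 ≤ r) (hF : ContDiff ℝ ∞ F)
    (hl : ∀ x ≤ η, F x = 0) (hr' : ∀ x, 1 - η ≤ x → F x = 0) (hd : ∀ x, deriv F x < 1) :
    IsSmoothJoin (σ δ) (τ δ) r (fun x => glueId (σ δ) (τ δ) δ x - F x) := by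
  have hg := contDiff_glueId h0 hδ (hσ.eq_self δ h0) (hτ.eq_self δ h0)
    (hσ.family.contDiff δ h0) (hτ.family.contDiff δ h0)
  have hf : ContDiff ℝ ∞ (fun x => glueId (σ δ) (τ δ) δ x - F x) := hg.sub hF
  have hL : ∀ x ∈ Icc 0 r, glueId (σ δ) (τ δ) δ x - F x = σ δ x := fun x hx => by
    rw [glueId_of_le (hx.2.trans hrδ), hl x (hx.2.trans hr), sub_zero]
  have hR : ∀ x ∈ Icc (1 - r) 1, glueId (σ δ) (τ δ) δ x - F x = τ δ x := fun x hx => by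
    rw [glueId_of_ge hδ (by linarith [hx.1]), hr' x (by linarith [hx.1]), sub_zero]
  have hpos : ∀ x ∈ Ioo (0 : ℝ) 1, 0 < deriv (fun x => glueId (σ δ) (τ δ) δ x - F x) x := by
    intro x hx
    have hgd : DifferentiableAt ℝ (glueId (σ δ) (τ δ) δ) x := hg.differentiable (by simp) x
    have hFd : DifferentiableAt ℝ F x := hF.differentiable (by simp) x
    rw [show deriv (fun x => glueId (σ δ) (τ δ) δ x - F x) x =
      deriv (glueId (σ δ) (τ δ) δ) x - deriv F x from (hgd.hasDerivAt.sub hFd.hasDerivAt).deriv]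
    have hgpos := deriv_glueId_pos h0 hδ (hσ.eq_self δ h0) (hτ.eq_self δ h0)
      (hσ.deriv_pos δ h0) (hτ.deriv_pos δ h0) hx
    -- Near such `x` the correction vanishes; elsewhere `δ / 2 < η` forces the glued slope to be
    -- `1`, which exceeds `F'`.
    by_cases h : x < η ∨ 1 - η < x
    · have : F =ᶠ[𝓝 x] fun _ => 0 := by
        rcases h with h | h
        · filter_upwards [Iio_mem_nhds h] with y hy using hl y (le_of_lt hy)
        · filter_upwards [Ioi_mem_nhds h] with y hy using hr' y (le_of_lt hy)
      rw [this.deriv_eq, deriv_const, sub_zero]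
      exact hgpos
    · push Not at h
      rw [deriv_glueId_of_mem (hσ.eq_self δ h0) (hτ.eq_self δ h0)
        ⟨by linarith [h.1], by linarith [h.2]⟩]
      linarith [hd x]
  refine ⟨hf.contDiffOn, mapsTo_Icc_of_deriv_pos hf.continuous.continuousOn ?_ ?_ hpos,
    hL, hR, hpos⟩
  · rw [hL 0 ⟨le_rfl, hr0⟩, hσ.map_zero δ h0]
  · rw [hR 1 ⟨by linarith, le_rfl⟩, hτ.map_one δ h0]

/-- Smooth joins realise, up to a small error, the moments of every unit step. -/
lemma exists_isSmoothJoin_near_step (hσ : IsLeftPieceFamily σ) (hτ : IsRightPieceFamily τ)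
    {u κ : ℝ} (hu : 0 < u) (hu' : u < 1) (hκ : 0 < κ) :
    ∃ δ₀ : ℝ, 0 < δ₀ ∧ ∀ δ : ℝ, 0 < δ → δ < δ₀ → ∃ f : ℝ → ℝ,
      IsSmoothJoin (σ δ) (τ δ) (δ / 2) f ∧ |integralOp f 1 - u| < κ ∧
        |integralOp (integralOp f) 1 - u ^ 2 / 2| < κ := by
  -- `3 * ε < κ` absorbs the moment errors; the other two bounds keep the jump at `1 - u` inside
  -- `[0, 1]`.
  obtain ⟨ε, hε, hεm⟩ : ∃ ε : ℝ, 0 < ε ∧ ε < min (κ / 3) (min (u / 2) ((1 - u) / 2)) :=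
    exists_between (by
      refine lt_min ?_ (lt_min ?_ ?_) <;> linarith)
  obtain ⟨h1, h2, h3⟩ : ε < κ / 3 ∧ ε < u / 2 ∧ ε < (1 - u) / 2 := by
    simpa only [lt_min_iff] using hεm
  obtain ⟨F, hF, hFl, hFr, hFd, hFs, hFs'⟩ :=
    exists_smooth_step_correction (s := 1 - u) hε (by linarith) (by linarith)
  -- `δ < ε / 4` puts the intervals where `f` is prescribed inside the zero set of `F`, and leaves
  -- total error at most `2 * ε` from the step outside its window.
  refine ⟨ε / 4, by linarith, fun δ h0 hδ => ?_⟩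
  have hδ' : δ < 1 / 2 := by linarith
  have hj := isSmoothJoin_glueId_sub hσ hτ h0 hδ' (η := ε / 4) (r := δ / 2) (by linarith)
    (by linarith) (by linarith) (by linarith) hF hFl hFr hFd
  have hclose : ∀ x ∈ Icc (0 : ℝ) 1, |glueId (σ δ) (τ δ) δ x - x| ≤ δ := fun x hx =>
    abs_glueId_sub_le h0 hδ' (hσ.eq_self δ h0) (hτ.eq_self δ h0) (hσ.mapsTo δ h0)
      (hτ.mapsTo δ h0) hx
  have hl : ∀ x ∈ Icc 0 (1 - u - ε), glueId (σ δ) (τ δ) δ x - F x ≤ 2 * ε := fun x hx => by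
    have := (abs_le.1 (hclose x ⟨hx.1, by linarith [hx.2]⟩)).2
    linarith [hFs x hx]
  have hr : ∀ x ∈ Icc (1 - u + ε) 1, 1 - 2 * ε ≤ glueId (σ δ) (τ δ) δ x - F x := fun x hx => by
    have := (abs_le.1 (hclose x ⟨by linarith [hx.1], hx.2⟩)).1
    linarith [hFs' x hx]
  refine ⟨_, hj, ?_, ?_⟩
  · have := abs_integralOp_sub_max_le hε (by linarith) (by linarith) hj.contDiffOn.continuousOn
      hj.mapsTo hl hr (right_mem_Icc.2 zero_le_one)
    rw [sub_sub_cancel, max_eq_left hu.le] at this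
    linarith
  · have := abs_integralOp_integralOp_sub_le hε (by linarith) (by linarith)
      hj.contDiffOn.continuousOn hj.mapsTo hl hr
    rw [sub_sub_cancel] at this
    linarith

end Families

/-! ### Triangles inscribed in the parabola -/

/-- Twice the signed area of the triangle with vertices `p`, `q` and `r`. -/
def signedArea (p q r : ℝ × ℝ) : ℝ :=
  (q.1 - p.1) * (r.2 - p.2) - (r.1 - p.1) * (q.2 - p.2)

/-- Being strictly inside a positively oriented triangle is stable under small perturbations of the
vertices. -/
lemma exists_signedArea_pos_of_near {p P₀ P₁ P₂ : ℝ × ℝ} (h₀ : 0 < signedArea p P₁ P₂)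
    (h₁ : 0 < signedArea p P₂ P₀) (h₂ : 0 < signedArea p P₀ P₁) :
    ∃ κ > 0, ∀ Q₀ Q₁ Q₂ : ℝ × ℝ, dist Q₀ P₀ < κ → dist Q₁ P₁ < κ → dist Q₂ P₂ < κ →
      0 < signedArea p Q₁ Q₂ ∧ 0 < signedArea p Q₂ Q₀ ∧ 0 < signedArea p Q₀ Q₁ := by
  have hopen : IsOpen {Q : (ℝ × ℝ) × (ℝ × ℝ) × (ℝ × ℝ) | 0 < signedArea p Q.2.1 Q.2.2 ∧
      0 < signedArea p Q.2.2 Q.1 ∧ 0 < signedArea p Q.1 Q.2.1} := by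
    simp only [signedArea, ofPred_and]
    exact (isOpen_lt (by fun_prop) (by fun_prop)).inter
      ((isOpen_lt (by fun_prop) (by fun_prop)).inter (isOpen_lt (by fun_prop) (by fun_prop)))
  obtain ⟨κ, hκ, hball⟩ := Metric.isOpen_iff.1 hopen (P₀, P₁, P₂) ⟨h₀, h₁, h₂⟩
  refine ⟨κ, hκ, fun Q₀ Q₁ Q₂ d₀ d₁ d₂ => ?_⟩
  have : (Q₀, Q₁, Q₂) ∈ Metric.ball (P₀, P₁, P₂) κ := by
    rw [Metric.mem_ball, Prod.dist_eq, Prod.dist_eq]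
    exact max_lt d₀ (max_lt d₁ d₂)
  exact hball this

/-- The second factor is the height of `(a, b)` above the line through the two parabola points, so
the sign is read off from it and the order of `u` and `v`. -/
lemma signedArea_parabola (a b u v : ℝ) :
    signedArea (a, b) (u, u ^ 2 / 2) (v, v ^ 2 / 2) =
      (v - u) * (b - a * (u + v) / 2 + u * v / 2) := by
  simp only [signedArea]
  ring

/-- Three points of the parabola `y = x ^ 2 / 2` around a point strictly between the parabola and
its chord over `[0, 1]`. -/
lemma exists_parabola_triangle {a b : ℝ} (h0 : 0 < a) (h1 : a < 1) (hb : a ^ 2 / 2 < b)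
    (hb' : b < a / 2) : ∃ u v : ℝ, (0 < u ∧ u < 1) ∧ (0 < v ∧ v < 1) ∧
      0 < signedArea (a, b) (a, a ^ 2 / 2) (v, v ^ 2 / 2) ∧
      0 < signedArea (a, b) (v, v ^ 2 / 2) (u, u ^ 2 / 2) ∧
      0 < signedArea (a, b) (u, u ^ 2 / 2) (a, a ^ 2 / 2) := by
  obtain ⟨e, he, hem⟩ : ∃ e : ℝ, 0 < e ∧ e < min (min a (1 - a)) (a / 2 - b) :=
    exists_between (by
      refine lt_min (lt_min ?_ ?_) ?_ <;> linarith)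
  obtain ⟨⟨h2, h3⟩, h4⟩ : (e < a ∧ e < 1 - a) ∧ e < a / 2 - b := by
    simpa only [lt_min_iff] using hem
  -- The two chords ending at `(a, a² / 2)` have height `a² / 2 < b` over `a`. The chord from `e` to
  -- `1 - e` has height `a / 2 - e * (1 - e) / 2`, which exceeds `b` because `e < a / 2 - b`.
  refine ⟨e, 1 - e, ⟨he, by linarith⟩, ⟨by linarith, by linarith⟩, ?_, ?_, ?_⟩ <;>
    rw [signedArea_parabola]
  · exact mul_pos (by linarith) (by nlinarith)
  · exact mul_pos_of_neg_of_neg (by linarith) (by nlinarith [mul_pos he he])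
  · exact mul_pos (by linarith) (by nlinarith)

lemma exists_isSmoothJoin_integralOp_eq {σ τ : ℝ → ℝ → ℝ} (hσ : IsLeftPieceFamily σ)
    (hτ : IsRightPieceFamily τ) {a b : ℝ} (h0 : 0 < a) (h1 : a < 1) (hb : a ^ 2 / 2 < b)
    (hb' : b < a / 2) :
    ∃ δ₀ : ℝ, 0 < δ₀ ∧ ∀ δ : ℝ, 0 < δ → δ < δ₀ →
      ∃ f : ℝ → ℝ, IsSmoothJoin (σ δ) (τ δ) (δ / 2) f ∧
        integralOp f 1 = a ∧ integralOp (integralOp f) 1 = b := by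
  obtain ⟨u, v, ⟨hu, hu'⟩, ⟨hv, hv'⟩, hA, hB, hC⟩ := exists_parabola_triangle h0 h1 hb hb'
  obtain ⟨κ, hκ, hstable⟩ := exists_signedArea_pos_of_near hA hB hC
  obtain ⟨δ₀, hδ₀, H₀⟩ := exists_isSmoothJoin_near_step hσ hτ hu hu' hκ
  obtain ⟨δ₁, hδ₁, H₁⟩ := exists_isSmoothJoin_near_step hσ hτ h0 h1 hκ
  obtain ⟨δ₂, hδ₂, H₂⟩ := exists_isSmoothJoin_near_step hσ hτ hv hv' hκ
  refine ⟨min δ₀ (min δ₁ δ₂), lt_min hδ₀ (lt_min hδ₁ hδ₂), fun δ hδ hlt => ?_⟩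
  obtain ⟨hlt₀, hlt₁, hlt₂⟩ : δ < δ₀ ∧ δ < δ₁ ∧ δ < δ₂ := by simpa only [lt_min_iff] using hlt
  obtain ⟨f₀, J₀, m₀, n₀⟩ := H₀ δ hδ hlt₀
  obtain ⟨f₁, J₁, m₁, n₁⟩ := H₁ δ hδ hlt₁
  obtain ⟨f₂, J₂, m₂, n₂⟩ := H₂ δ hδ hlt₂
  obtain ⟨d₀, d₁, d₂⟩ := hstable (integralOp f₀ 1, integralOp (integralOp f₀) 1)
    (integralOp f₁ 1, integralOp (integralOp f₁) 1)
    (integralOp f₂ 1, integralOp (integralOp f₂) 1) (max_lt m₀ n₀) (max_lt m₁ n₁) (max_lt m₂ n₂)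
  -- `Dᵢ` is the area opposite vertex `i`, hence proportional to the barycentric coordinate of `(a,
  -- b)` at that vertex. The three-term combination is formed as two nested two-term ones.
  set D₀ := signedArea (a, b) (integralOp f₁ 1, integralOp (integralOp f₁) 1)
    (integralOp f₂ 1, integralOp (integralOp f₂) 1) with hD₀
  set D₁ := signedArea (a, b) (integralOp f₂ 1, integralOp (integralOp f₂) 1)
    (integralOp f₀ 1, integralOp (integralOp f₀) 1) with hD₁
  set D₂ := signedArea (a, b) (integralOp f₀ 1, integralOp (integralOp f₀) 1)
    (integralOp f₁ 1, integralOp (integralOp f₁) 1) with hD₂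
  have hS : 0 < D₀ + D₁ := by linarith
  have hT : 0 < D₀ + D₁ + D₂ := by linarith
  have J := J₀.convexComb J₁ (p := D₀ / (D₀ + D₁)) (q := D₁ / (D₀ + D₁)) (by positivity)
    (by positivity) (by field_simp)
  have J' := J.convexComb J₂ (p := (D₀ + D₁) / (D₀ + D₁ + D₂)) (q := D₂ / (D₀ + D₁ + D₂))
    (by positivity) (by positivity) (by field_simp)
  have h1m : (1 : ℝ) ∈ Icc (0 : ℝ) 1 := right_mem_Icc.2 zero_le_one
  refine ⟨_, J', ?_, ?_⟩
  · rw [integralOp_convexComb J.contDiffOn.continuousOn J₂.contDiffOn.continuousOn _ _ h1m,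
      integralOp_convexComb J₀.contDiffOn.continuousOn J₁.contDiffOn.continuousOn _ _ h1m]
    field_simp
    simp only [hD₀, hD₁, hD₂, signedArea]
    ring
  · rw [integralOp_integralOp_convexComb J.contDiffOn.continuousOn J₂.contDiffOn.continuousOn
        _ _ h1m,
      integralOp_integralOp_convexComb J₀.contDiffOn.continuousOn J₁.contDiffOn.continuousOn
        _ _ h1m]
    field_simp
    simp only [hD₀, hD₁, hD₂, signedArea]
    ring

theorem corollaryc (σ τ : ℝ → ℝ → ℝ) (hσ : IsLeftPieceFamily σ) (hτ : IsRightPieceFamily τ) :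
    (∃ δ₀ : ℝ, 0 < δ₀ ∧ ∀ δ : ℝ, 0 < δ → δ < δ₀ →
      ∃ f : ℝ → ℝ, IsSmoothJoin (σ δ) (τ δ) δ f) ∧
    (∀ a : ℝ, 0 < a → a < 1 →
      ∃ δ₀ : ℝ, 0 < δ₀ ∧ ∀ δ : ℝ, 0 < δ → δ < δ₀ →
        ∃ f : ℝ → ℝ, IsSmoothJoin (σ δ) (τ δ) (δ / 2) f ∧ integralOp f 1 = a) ∧
    (∀ a b : ℝ, 0 < a → a < 1 → a ^ 2 / 2 < b → b < a / 2 →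
      ∃ δ₀ : ℝ, 0 < δ₀ ∧ ∀ δ : ℝ, 0 < δ → δ < δ₀ →
        ∃ f : ℝ → ℝ, IsSmoothJoin (σ δ) (τ δ) (δ / 2) f ∧
          integralOp f 1 = a ∧ integralOp (integralOp f) 1 = b) := by
  refine ⟨⟨1 / 2, by norm_num, fun δ h0 hδ => ?_⟩, fun a h0 h1 => ?_, fun a b h0 h1 hb hb' =>
    exists_isSmoothJoin_integralOp_eq hσ hτ h0 h1 hb hb'⟩
  -- With no correction the glued function itself serves, matching the pieces on the full collars.
  · exact ⟨_, isSmoothJoin_glueId_sub hσ hτ h0 hδ (F := fun _ => 0) (η := δ) (by linarith) le_rfl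
      le_rfl h0.le contDiff_const (fun _ _ => rfl) (fun _ _ => rfl) (by simp)⟩
  -- Any admissible second moment will do; one exists since `a² < a`.
  · obtain ⟨b, hb, hb'⟩ : ∃ b, a ^ 2 / 2 < b ∧ b < a / 2 := exists_between (by nlinarith)
    obtain ⟨δ₀, hδ₀, H⟩ := exists_isSmoothJoin_integralOp_eq hσ hτ h0 h1 hb hb'
    refine ⟨δ₀, hδ₀, fun δ h hlt => ?_⟩
    obtain ⟨f, hf, hfa, -⟩ := H δ h hlt
    exact ⟨f, hf, hfa⟩
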